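/- Let $(R,\mathfrak m)$ be a complete discrete valuation ring with finite residue field $R/\mathfrak m=\mathbb F_q$, and for $n\ge 0$ let $\mathrm{Mat}_n(R)$ be the compact additive group of $n\times n$ matrices over $R$ (with the $\mathfrak m$-adic topology), equipped with its Haar probability measure. Let $P(t)\in R[t]$ be a monic polynomial whose reduction $\overline P(t)\in\mathbb F_q[t]$ modulo $\mathfrak m$ is irreducible. For $A\in\mathrm{Mat}_n(R)$ let $\operatorname{coker}(P(A))=R^n/P(A)R^n$. Then for every $n\ge 0$ $$\operatorname{Prob}_{A\in \mathrm{Mat}_n(R)}\bigl(\operatorname{coker}(P(A))=0\bigr)=b_n(\deg P)\prod_{i=1}^{n}(1-q^{-i}),$$ where, for every integer $d\ge 0$, the numbers $b_n(d)$ $(n\ge 0)$ are given by $$\sum_{n=0}^{\infty}b_n(d)\,u^n=\prod_{i=1}^{\infty}\frac{1-(q^{-i}u)^d}{1-q^{1-i}u}\in\mathbb C[[u]],$$ the infinite product being convergent in $\mathbb C[[u]]$ coefficientwise. Moreover, for every integer $d\ge 0$, $$\lim_{n\to\infty}b_n(d)=\prod_{i=1}^{\infty}\frac{1-q^{-id}}{1-q^{-i}},$$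 and in particular $$\lim_{n\to\infty}\operatorname{Prob}_{A\in \mathrm{Mat}_n(R)}\bigl(\operatorname{coker}(P(A))=0\bigr)=\prod_{i=1}^{\infty}\bigl(1-q^{-i\deg P}\bigr).$$ -/

import Mathlib

open scoped PowerSeries.WithPiTopology

noncomputable section

/-- The `𝔪`-adic topology on a local ring. -/
abbrev maxAdicTopology (R : Type*) [CommRing R] [IsLocalRing R] : TopologicalSpace R :=
  (IsLocalRing.maximalIdeal R).adicTopology

/-- A complete discrete valuation ring with finite residue field is compact. -/
theorem compactSpace_maxAdicTopology (R : Type*) [CommRing R] [IsDomain R]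
    [IsDiscreteValuationRing R] [IsAdicComplete (IsLocalRing.maximalIdeal R) R]
    [Finite (IsLocalRing.ResidueField R)] : @CompactSpace R (maxAdicTopology R) := by
  let : WithIdeal R := ⟨IsLocalRing.maximalIdeal R⟩
  have hI : IsAdic (IsLocalRing.maximalIdeal R) := rfl
  have hc : CompleteSpace R := (hI.isAdicComplete_iff.mp inferInstance).1
  change CompactSpace R
  rw [← isCompact_univ_iff, isCompact_iff_totallyBounded_isComplete]
  refine ⟨?_, completeSpace_iff_isComplete_univ.mp hc⟩
  rw [totallyBounded_iff_subset_finite_iUnion_nhds_zero]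
  intro U hU
  obtain ⟨n, -, hn⟩ := hI.hasBasis_nhds_zero.mem_iff.mp hU
  have : Finite (R ⧸ IsLocalRing.maximalIdeal R) :=
    inferInstanceAs (Finite (IsLocalRing.ResidueField R))
  have : Finite (R ⧸ IsLocalRing.maximalIdeal R ^ n) :=
    Ideal.finite_quotient_pow (IsNoetherian.noetherian _) n
  refine ⟨Set.range (fun x : R ⧸ IsLocalRing.maximalIdeal R ^ n => Quotient.out x),
    Set.finite_range _, fun x _ => ?_⟩
  simp only [Set.mem_iUnion]
  refine ⟨_, ⟨Ideal.Quotient.mk _ x, rfl⟩, ?_⟩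
  refine Set.mem_vadd_set_iff_neg_vadd_mem.mpr (hn ?_)
  rw [vadd_eq_add, neg_add_eq_sub]
  refine Ideal.Quotient.eq.mp ?_
  exact (Quotient.out_eq (Ideal.Quotient.mk (IsLocalRing.maximalIdeal R ^ n) x)).symm

/-- The topology on `n × n` matrices over `R`: entrywise (product) `𝔪`-adic topology. -/
@[reducible]
def matrixAdicTopology (R : Type*) [CommRing R] [IsLocalRing R] (n : ℕ) :
    TopologicalSpace (Matrix (Fin n) (Fin n) R) :=
  letI := maxAdicTopology R
  inferInstance

theorem matrixAdicTopology_isTopologicalAddGroup (R : Type*) [CommRing R] [IsLocalRing R] (n : ℕ) :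
    @IsTopologicalAddGroup (Matrix (Fin n) (Fin n) R) (matrixAdicTopology R n) _ := by
  letI : WithIdeal R := ⟨IsLocalRing.maximalIdeal R⟩
  exact inferInstanceAs (IsTopologicalAddGroup (Matrix (Fin n) (Fin n) R))

theorem matrixAdicTopology_compactSpace (R : Type*) [CommRing R] [IsDomain R]
    [IsDiscreteValuationRing R] [IsAdicComplete (IsLocalRing.maximalIdeal R) R]
    [Finite (IsLocalRing.ResidueField R)] (n : ℕ) :
    @CompactSpace (Matrix (Fin n) (Fin n) R) (matrixAdicTopology R n) := by
  letI := maxAdicTopology R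
  haveI := compactSpace_maxAdicTopology R
  exact inferInstanceAs (CompactSpace (Fin n → Fin n → R))

/-- The Borel `σ`-algebra on `n × n` matrices over `R`. -/
@[reducible]
def matrixBorel (R : Type*) [CommRing R] [IsLocalRing R] (n : ℕ) :
    MeasurableSpace (Matrix (Fin n) (Fin n) R) :=
  @borel _ (matrixAdicTopology R n)

/-- The Haar probability measure on the compact additive group `Mat_n(R)`: the Haar measure
giving the whole group mass `1`. -/
def haarMatrix (R : Type*) [CommRing R] [IsDomain R] [IsDiscreteValuationRing R]
    [IsAdicComplete (IsLocalRing.maximalIdeal R) R] [Finite (IsLocalRing.ResidueField R)] (n : ℕ) :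
    @MeasureTheory.Measure (Matrix (Fin n) (Fin n) R) (matrixBorel R n) :=
  letI := matrixAdicTopology R n
  letI := matrixBorel R n
  haveI : BorelSpace (Matrix (Fin n) (Fin n) R) := ⟨rfl⟩
  haveI := matrixAdicTopology_isTopologicalAddGroup R n
  haveI := matrixAdicTopology_compactSpace R n
  MeasureTheory.Measure.addHaarMeasure ⊤

/-- The cokernel of an `n × n` matrix, seen as an endomorphism of `R^n`. -/
abbrev matrixCoker {R : Type*} [CommRing R] {n : ℕ} (M : Matrix (Fin n) (Fin n) R) : Type _ :=
  (Fin n → R) ⧸ LinearMap.range M.mulVecLin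

/-- The set of `A ∈ Mat_n(R)` such that `coker (P(A)) = 0`. -/
def cokerZeroEvent {R : Type*} [CommRing R] (P : Polynomial R) (n : ℕ) :
    Set (Matrix (Fin n) (Fin n) R) :=
  {A | Subsingleton (matrixCoker (Polynomial.aeval A P))}

/-- The factor `(1 - (q^{-i} u)^d) / (1 - q^{1-i} u)` in `ℂ⟦u⟧`. -/
def bFactor (q d i : ℕ) : PowerSeries ℂ :=
  (1 - (PowerSeries.C ((q : ℂ) ^ (-(i : ℤ))) * PowerSeries.X) ^ d) *
    (1 - PowerSeries.C ((q : ℂ) ^ (1 - (i : ℤ))) * PowerSeries.X)⁻¹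

/-- `b_n(d)`: the coefficient of `u^n` in `∏_{i ≥ 1} (1 - (q^{-i} u)^d) / (1 - q^{1-i} u)`, the
infinite product being taken in `ℂ⟦u⟧` for coefficientwise convergence. -/
def bCoeff (q n d : ℕ) : ℂ :=
  PowerSeries.coeff n (∏' i : ℕ, bFactor q d (i + 1))

end

/-! Write `F` for the residue field, `p` for the reduction of `P`, `d = deg p`, `Q = q^d`. Since `R`
is local, `P(A)` is invertible iff `p` of the reduced matrix is, and Haar measure reduces to the
uniform measure on matrices over `F`. It remains to find the proportion of `A ∈ End(V)`, `dim V =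
n`, with `ker p(A) = 0`.

The kernel is a vector space over the field `L = F[X]/(p)` of size `Q`; let `r` be its dimension.
There are `∏_{i<k} (Q^r - Q^i)` injective `L`-maps `L^k → ker p(A)`, and a finite q-binomial
identity inverts these counts: a combination with coefficients `eulerCoeff Q k` equals the indicator
of `r = 0` (`Module.End.indicator_isUnit_aeval`). Averaging over `A` is then easy, because such a
map is an injective `F`-map `φ : L^k → V` intertwining `X` with `A`. For fixed `φ` the condition on
`A` is affine, so exactly a fraction `q^{-ndk}` of all `A` qualify. The proportion is therefore `∑_k
eulerCoeff Q k * ∏_{i<dk} (1 - q^{i-n})` (`Module.End.card_isUnit_aeval`).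

On the other side, the generating product is the unique series with constant term 1 and `(1 - u)
f(u) = (1 - (u/q)^d) f(u/q)`. This identifies it with Euler's expansions of its numerator and
denominator, multiplied together (`tprod_bFactor_eq`). The resulting convolution for `b_n(d)`, times
`∏_{j≤n} (1 - q^{-j})`, is the sum above (`bCoeff_mul_prod`). The limits follow from dominated
convergence in the convolution and Euler's identity at `u = 1`. -/

/-! ### The kernel of `p(A)` over `F[X]/(p)`. -/

open Polynomial in
theorem Module.End.coe_aeval_restrict {F V : Type*} [Field F] [AddCommGroup V] [Module F V]
    (A : Module.End F V) (K : Submodule F V) (h : ∀ x ∈ K, A x ∈ K) (g : F[X]) (x : K) :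
    (aeval (A.restrict h) g x : V) = aeval A g (x : V) := by
  induction g using Polynomial.induction_on' generalizing x with
  | add f g hf hg => simp [hf, hg]
  | monomial n a =>
    have : ∀ (n : ℕ) (x : K), (((A.restrict h) ^ n) x : V) = (A ^ n) (x : V) := by
      intro n
      induction n with
      | zero => simp
      | succ n ih => intro x; simp [pow_succ, ih]
    simp [aeval_monomial, this]

theorem Module.End.ker_aeval_invariant {F V : Type*} [Field F] [AddCommGroup V] [Module F V]
    (A : Module.End F V) (p : Polynomial F) :
    ∀ x ∈ (Polynomial.aeval A p).ker, A x ∈ (Polynomial.aeval A p).ker := by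
  intro x hx
  rw [LinearMap.mem_ker] at hx ⊢
  have h : A * Polynomial.aeval A p = Polynomial.aeval A p * A := by
    simpa using ((Polynomial.commute_X p).map (Polynomial.aeval A)).eq
  rw [← Module.End.mul_apply, ← h, Module.End.mul_apply, hx, map_zero]

/-- The kernel of `p(A)` is a module over `F[X] / (p)`, with `X` acting as `A`. -/
noncomputable abbrev Module.End.kerAevalModule {F V : Type*} [Field F] [AddCommGroup V] [Module F V]
    (A : Module.End F V) (p : Polynomial F) :
    Module (AdjoinRoot p) (Polynomial.aeval A p).ker :=
  Module.compHom _ (Ideal.Quotient.lift (Ideal.span {p})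
    (Polynomial.aeval (A.restrict (A.ker_aeval_invariant p))).toRingHom (by
      intro a ha
      obtain ⟨b, rfl⟩ := Ideal.mem_span_singleton.mp ha
      ext x
      have hx := x.2
      rw [LinearMap.mem_ker] at hx
      rw [mul_comm]
      simp only [AlgHom.toRingHom_eq_coe, RingHom.coe_coe, map_mul, Module.End.mul_apply,
        LinearMap.zero_apply, Module.End.coe_aeval_restrict, hx, map_zero, ZeroMemClass.coe_zero]) :
    AdjoinRoot p →+* Module.End F (Polynomial.aeval A p).ker)

theorem Module.End.coe_mk_smul {F V : Type*} [Field F] [AddCommGroup V] [Module F V]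
    (A : Module.End F V) (p g : Polynomial F) (x : (Polynomial.aeval A p).ker) :
    letI := A.kerAevalModule p
    ((AdjoinRoot.mk p g • x : (Polynomial.aeval A p).ker) : V) = Polynomial.aeval A g (x : V) := by
  exact A.coe_aeval_restrict _ (A.ker_aeval_invariant p) g x

/-- A map from a free `F[X] / (p)`-module commuting with the action of `X` commutes with
the action of every polynomial. -/
theorem LinearMap.map_mk_smul_of_intertwines {F V W : Type*} [Field F] [AddCommGroup V] [Module F V]
    (A : Module.End F V) (p : Polynomial F) [AddCommGroup W] [Module F W] [Module (AdjoinRoot p) W]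
    [IsScalarTower F (AdjoinRoot p) W]
    (φ : W →ₗ[F] V) (h : ∀ w, φ (AdjoinRoot.root p • w) = A (φ w)) (g : Polynomial F) (w : W) :
    φ (AdjoinRoot.mk p g • w) = Polynomial.aeval A g (φ w) := by
  have hn : ∀ (n : ℕ) (w : W), φ (AdjoinRoot.root p ^ n • w) = (A ^ n) (φ w) := by
    intro n
    induction n with
    | zero => simp
    | succ n ih => intro w; rw [pow_succ, mul_smul, ih, h, pow_succ, Module.End.mul_apply]
  induction g using Polynomial.induction_on' generalizing w with
  | add f g hf hg => simp [hf, hg, add_smul]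
  | monomial n a =>
    rw [← Polynomial.C_mul_X_pow_eq_monomial, map_mul, AdjoinRoot.mk_C, map_pow, AdjoinRoot.mk_X,
      mul_smul, ← AdjoinRoot.algebraMap_eq, algebraMap_smul, map_smul, hn]
    simp

/-- Maps over `F[X] / (p)` into `ker p(A)` are the same as `F`-linear maps intertwining `X`
and `A`. -/
theorem Module.End.card_injective_intertwiners {F V : Type*} [Field F]
    [AddCommGroup V] [Module F V]
    (A : Module.End F V) (p : Polynomial F) (W : Type*) [AddCommGroup W] [Module F W]
    [Module (AdjoinRoot p) W] [IsScalarTower F (AdjoinRoot p) W] :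
    letI := A.kerAevalModule p
    Nat.card {ψ : W →ₗ[AdjoinRoot p] (Polynomial.aeval A p).ker // Function.Injective ψ} =
    Nat.card {φ : W →ₗ[F] V // Function.Injective φ ∧ ∀ w, φ (AdjoinRoot.root p • w) = A (φ w)} := by
  let := A.kerAevalModule p
  -- The kernel carries two `F`-actions, the one inherited from `V` and the one through `F[X]/(p)`;
  -- they must agree for an `F[X]/(p)`-linear map to be `F`-linear into `V`.
  have hsm : ∀ (a : F) (x : (Polynomial.aeval A p).ker), algebraMap F (AdjoinRoot p) a • x = a • x := by
    intro a x
    rw [AdjoinRoot.algebraMap_eq, ← AdjoinRoot.mk_C]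
    ext
    rw [A.coe_mk_smul]
    simp
  refine Nat.card_congr (Equiv.ofBijective (fun ψ => ⟨
    { toFun := fun w => (ψ.1 w : V)
      map_add' := by simp
      map_smul' := by
        intro a w
        rw [← algebraMap_smul (AdjoinRoot p) a w, map_smul, hsm]
        simp }, ?_, ?_⟩) ⟨?_, ?_⟩)
  · intro x y hxy
    exact ψ.2 (Subtype.ext hxy)
  · intro w
    have := A.coe_mk_smul p Polynomial.X (ψ.1 w)
    rw [AdjoinRoot.mk_X] at this
    simp [this]
  · intro ψ ψ' h
    ext w
    exact congrArg (fun φ => φ.1 w) h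
  · rintro ⟨φ, hinj, hφ⟩
    have key := LinearMap.map_mk_smul_of_intertwines A p φ hφ
    have hker : ∀ w, φ w ∈ (Polynomial.aeval A p).ker := by
      intro w
      rw [LinearMap.mem_ker, ← key, AdjoinRoot.mk_self, zero_smul, map_zero]
    refine ⟨⟨{ toFun := fun w => ⟨φ w, hker w⟩
               map_add' := by intro x y; ext; simp
               map_smul' := ?_ }, ?_⟩, ?_⟩
    · intro a w
      obtain ⟨g, rfl⟩ := AdjoinRoot.mk_surjective a
      ext
      simp only [RingHom.id_apply]
      rw [A.coe_mk_smul, key]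
    · intro x y hxy
      exact hinj (congrArg Subtype.val hxy)
    · rfl

/-! ### Counting injective maps and extensions. -/

/-- The number of injective linear maps between finite vector spaces. -/
theorem card_injective_linearMap (K V W : Type*) [Field K] [Finite K] [AddCommGroup V] [Module K V]
    [Module.Finite K V] [AddCommGroup W] [Module K W] [Module.Finite K W] :
    (Nat.card {φ : W →ₗ[K] V // Function.Injective φ} : ℂ) =
      ∏ i ∈ Finset.range (Module.finrank K W),
        ((Nat.card K : ℂ) ^ Module.finrank K V - (Nat.card K : ℂ) ^ i) := by
  have : Fintype K := Fintype.ofFinite K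
  have : Finite V := Module.finite_of_finite K
  have hq : 1 ≤ Fintype.card K := Fintype.card_pos
  by_cases h : Module.finrank K W ≤ Module.finrank K V
  · have e : {φ : W →ₗ[K] V // Function.Injective φ} ≃
        {s : Fin (Module.finrank K W) → V // LinearIndependent K s} := by
      let b := Module.finBasis K W
      refine ((b.constr K).symm.toEquiv.subtypeEquiv ?_)
      intro φ
      have : (b.constr K).symm φ = φ ∘ b := by
        ext i; simp [Module.Basis.constr_symm_apply]
      simp only [LinearEquiv.coe_toEquiv]
      rw [this]
      constructor
      · intro hφ
        exact b.linearIndependent.map' φ (LinearMap.ker_eq_bot.mpr hφ)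
      · intro hli
        have h1 : b.constr K (φ ∘ b) = φ := b.constr_eq K (fun _ => rfl)
        rw [← h1]
        exact b.injective_constr_of_linearIndependent hli
    rw [Nat.card_congr e, card_linearIndependent h, Nat.card_eq_fintype_card,
      Finset.prod_range]
    push_cast
    refine Finset.prod_congr rfl fun i _ => ?_
    rw [Nat.cast_sub (Nat.pow_le_pow_right hq (i.2.le.trans h))]
    push_cast; rfl
  -- If `dim W > dim V`, both sides vanish: the product contains the factor `i = dim V`.
  · have : IsEmpty {φ : W →ₗ[K] V // Function.Injective φ} :=
      ⟨fun φ => h (LinearMap.finrank_le_finrank_of_injective φ.2)⟩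
    rw [Nat.card_of_isEmpty, Nat.cast_zero, eq_comm]
    exact Finset.prod_eq_zero (Finset.mem_range.mpr (not_le.mp h)) (sub_self _)

/-- For an injective `φ` the endomorphisms extending a given map along `φ` form a coset of
a space of known dimension. -/
theorem card_extensions {K V W : Type*} [Field K] [Finite K] [AddCommGroup V] [Module K V]
    [Module.Finite K V] [AddCommGroup W] [Module K W] [Module.Finite K W]
    (φ : W →ₗ[K] V) (hφ : Function.Injective φ) (ψ : W →ₗ[K] V) :
    (Nat.card {A : Module.End K V // ∀ w, ψ w = A (φ w)} : ℂ) *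
      ((Nat.card K : ℂ) ^ Module.finrank K V) ^ Module.finrank K W =
      Nat.card (Module.End K V) := by
  obtain ⟨g, hg⟩ := LinearMap.exists_leftInverse_of_injective φ (LinearMap.ker_eq_bot.mpr hφ)
  have hg' : ∀ w, g (φ w) = w := fun w => LinearMap.congr_fun hg w
  let T : Module.End K V →ₗ[K] (W →ₗ[K] V) := LinearMap.lcomp K V φ
  have hT : Function.Surjective T := by
    intro χ
    refine ⟨χ ∘ₗ g, ?_⟩
    ext w
    simp [T, hg']
  -- Subtracting the particular solution `ψ ∘ g` turns the affine condition into membership in the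
  -- kernel of restriction along `φ`.
  have e : {A : Module.End K V // ∀ w, ψ w = A (φ w)} ≃ T.ker := by
    refine ((Equiv.subRight (ψ ∘ₗ g)).subtypeEquiv ?_)
    intro A
    simp only [Equiv.subRight_apply, LinearMap.mem_ker, LinearMap.ext_iff, T]
    refine forall_congr' fun w => ?_
    simp [hg', sub_eq_zero, eq_comm (a := ψ w)]
  have h1 := Submodule.card_eq_card_quotient_mul_card T.ker
  rw [Nat.card_congr (T.quotKerEquivOfSurjective hT).toEquiv,
    Module.natCard_eq_pow_finrank (K := K) (V := W →ₗ[K] V), Module.finrank_linearMap] at h1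
  rw [Nat.card_congr e, h1]
  push_cast
  rw [← pow_mul, mul_comm (Module.finrank K W)]

/-! ### The inversion identity. -/

/-- The coefficients `(-1)^k / ∏_{j=1}^k (Q^j - 1)` of `∏_{i ≥ 1} (1 - Q^{-i} u)`. -/
noncomputable def eulerCoeff (Q : ℂ) (k : ℕ) : ℂ :=
  (-1) ^ k / ∏ j ∈ Finset.range k, (Q ^ (j + 1) - 1)

theorem eulerCoeff_succ (Q : ℂ) (k : ℕ) :
    eulerCoeff Q (k + 1) = -eulerCoeff Q k / (Q ^ (k + 1) - 1) := by
  rw [eulerCoeff, eulerCoeff, Finset.prod_range_succ, pow_succ]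
  field_simp

/-- A finite form of the `q`-binomial theorem. -/
theorem sum_eulerCoeff_mul_prod_sub (Q x : ℂ) (hQ : ∀ j : ℕ, Q ^ (j + 1) - 1 ≠ 0) (N : ℕ) :
    ∑ k ∈ Finset.range (N + 1), eulerCoeff Q k * ∏ i ∈ Finset.range k, (x - Q ^ i) =
      ∏ j ∈ Finset.range N, ((Q ^ (j + 1) - x) / (Q ^ (j + 1) - 1)) := by
  induction N with
  | zero => simp [eulerCoeff]
  | succ N ih =>
    have hne : ∏ j ∈ Finset.range N, (Q ^ (j + 1) - 1) ≠ 0 :=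
      Finset.prod_ne_zero_iff.mpr fun j _ => hQ j
    -- The sign matches the numerator of the new term with the partial product; it cancels against
    -- the `(-1)^(N+1)` in `eulerCoeff` up to the sign of `x - 1`.
    have hneg : ∏ j ∈ Finset.range N, (x - Q ^ (j + 1)) =
        (-1) ^ N * ∏ j ∈ Finset.range N, (Q ^ (j + 1) - x) := by
      have := Finset.prod_const (s := Finset.range N) (-1 : ℂ)
      rw [Finset.card_range] at this
      rw [← this, ← Finset.prod_mul_distrib]
      exact Finset.prod_congr rfl fun j _ => by ring
    rw [Finset.sum_range_succ, ih, Finset.prod_range_succ', hneg, Finset.prod_range_succ,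
      Finset.prod_div_distrib, eulerCoeff, Finset.prod_range_succ]
    have h1 := hQ N
    have h2 : ((-1 : ℂ) ^ N) * (-1) ^ N = 1 := by rw [← mul_pow]; simp
    field_simp
    linear_combination (-(x - 1)) * (∏ j ∈ Finset.range N, (Q ^ (j + 1) - x)) * h2

/-- At `x = Q^r` the closed product has a zero factor when `1 ≤ r ≤ N`, and all factors are 1 when
`r = 0`. This turns counts of injections into a test for dimension zero. -/
theorem sum_eulerCoeff_mul_prod_pow_sub (Q : ℂ) (hQ : ∀ j : ℕ, Q ^ (j + 1) - 1 ≠ 0) {r N : ℕ}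
    (h : r ≤ N) :
    ∑ k ∈ Finset.range (N + 1), eulerCoeff Q k * ∏ i ∈ Finset.range k, (Q ^ r - Q ^ i) =
      if r = 0 then 1 else 0 := by
  rw [sum_eulerCoeff_mul_prod_sub Q _ hQ]
  split_ifs with hr
  · subst hr
    exact Finset.prod_eq_one fun j _ => by rw [pow_zero, div_self (hQ j)]
  · refine Finset.prod_eq_zero (i := r - 1) (Finset.mem_range.mpr (by omega)) ?_
    rw [Nat.sub_add_cancel (Nat.pos_of_ne_zero hr), sub_self, zero_div]

/-! ### The proportion over a finite field. -/

theorem AdjoinRoot.card_eq {F : Type*} [Field F] [Finite F] (p : Polynomial F) (hp : p ≠ 0) :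
    Nat.card (AdjoinRoot p) = Nat.card F ^ p.natDegree := by
  have := (AdjoinRoot.powerBasis hp).finite
  rw [Module.natCard_eq_pow_finrank (K := F), (AdjoinRoot.powerBasis hp).finrank,
    AdjoinRoot.powerBasis_dim]

/-- The inversion identity applied to `r = dim_L ker p(A)`, where `L = F[X]/(p)`: the intertwiners
counted on the right are the injective `L`-maps into the kernel, and `p(A)` is a unit iff `r = 0`.
-/
theorem Module.End.indicator_isUnit_aeval {F V : Type*} [Field F] [_root_.Finite F] [AddCommGroup V]
    [Module F V] [Module.Finite F V] (p : Polynomial F) (hp : Irreducible p) (A : Module.End F V)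
    [Decidable (IsUnit (Polynomial.aeval A p))] :
    (if IsUnit (Polynomial.aeval A p) then 1 else 0 : ℂ) =
      ∑ k ∈ Finset.range (Module.finrank F V + 1), eulerCoeff ((Nat.card F : ℂ) ^ p.natDegree) k *
        (Nat.card {φ : (Fin k → AdjoinRoot p) →ₗ[F] V //
          Function.Injective φ ∧ ∀ w, φ (AdjoinRoot.root p • w) = A (φ w)} : ℂ) := by
  have : Fact (Irreducible p) := ⟨hp⟩
  have hF : 1 < Nat.card F := _root_.Finite.one_lt_card
  have hd : p.natDegree ≠ 0 := hp.natDegree_pos.ne'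
  have hL := AdjoinRoot.card_eq p hp.ne_zero
  have : _root_.Finite (AdjoinRoot p) := Nat.finite_of_card_ne_zero (by rw [hL]; positivity)
  let := A.kerAevalModule p
  have : _root_.Finite V := Module.finite_of_finite F
  have : Module.Finite (AdjoinRoot p) (Polynomial.aeval A p).ker := Module.Finite.of_finite
  have hQ : ∀ j : ℕ, ((Nat.card F : ℂ) ^ p.natDegree) ^ (j + 1) - 1 ≠ 0 := by
    intro j h
    rw [sub_eq_zero, ← pow_mul] at h
    have h' : Nat.card F ^ (p.natDegree * (j + 1)) = 1 := by exact_mod_cast h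
    rw [Nat.pow_eq_one] at h'
    rcases h' with h' | h'
    · omega
    · simp [hd] at h'
  -- Comparing cardinalities, `q^{dr} ≤ q^n`, so `r ≤ n` and the sum may stop at `k = n`.
  have hr : Module.finrank (AdjoinRoot p) (Polynomial.aeval A p).ker ≤ Module.finrank F V := by
    have h1 : Nat.card (Polynomial.aeval A p).ker ≤ Nat.card V := _root_.Finite.card_subtype_le _
    rw [Module.natCard_eq_pow_finrank (K := AdjoinRoot p), hL,
      Module.natCard_eq_pow_finrank (K := F) (V := V), ← pow_mul] at h1
    have := (Nat.pow_le_pow_iff_right hF).mp h1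
    exact (Nat.le_mul_of_pos_left _ (Nat.pos_of_ne_zero hd)).trans this
  have hu : IsUnit (Polynomial.aeval A p) ↔
      Module.finrank (AdjoinRoot p) (Polynomial.aeval A p).ker = 0 := by
    rw [LinearMap.isUnit_iff_ker_eq_bot, Module.finrank_zero_iff, Submodule.subsingleton_iff_eq_bot]
  have hcard : ∀ k : ℕ, (Nat.card {φ : (Fin k → AdjoinRoot p) →ₗ[F] V //
          Function.Injective φ ∧ ∀ w, φ (AdjoinRoot.root p • w) = A (φ w)} : ℂ) =
      ∏ i ∈ Finset.range k, (((Nat.card F : ℂ) ^ p.natDegree) ^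
        Module.finrank (AdjoinRoot p) (Polynomial.aeval A p).ker -
          ((Nat.card F : ℂ) ^ p.natDegree) ^ i) := by
    intro k
    rw [← A.card_injective_intertwiners p (Fin k → AdjoinRoot p), card_injective_linearMap, hL,
      Module.finrank_fin_fun]
    push_cast; rfl
  simp only [hcard]
  rw [sum_eulerCoeff_mul_prod_pow_sub _ hQ hr]
  simp only [hu]

/-- The proportion of endomorphisms `A` with `p(A)` invertible, for `p` irreducible. -/
theorem Module.End.card_isUnit_aeval {F V : Type*} [Field F] [_root_.Finite F] [AddCommGroup V]
    [Module F V] [Module.Finite F V] (p : Polynomial F) (hp : Irreducible p) :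
    (Nat.card {A : Module.End F V // IsUnit (Polynomial.aeval A p)} : ℂ) /
        Nat.card (Module.End F V) =
      ∑ k ∈ Finset.range (Module.finrank F V + 1), eulerCoeff ((Nat.card F : ℂ) ^ p.natDegree) k *
        ∏ i ∈ Finset.range (p.natDegree * k),
          (1 - (Nat.card F : ℂ) ^ i / (Nat.card F : ℂ) ^ Module.finrank F V) := by
  classical
  have hq0 : (Nat.card F : ℂ) ≠ 0 := by exact_mod_cast Nat.card_pos.ne'
  have : _root_.Finite V := Module.finite_of_finite F
  have hfE : _root_.Finite (Module.End F V) := _root_.Finite.of_injective _ DFunLike.coe_injective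
  have hE0 : (Nat.card (Module.End F V) : ℂ) ≠ 0 := by exact_mod_cast Nat.card_pos.ne'
  have := Fintype.ofFinite (Module.End F V)
  have hL := AdjoinRoot.card_eq p hp.ne_zero
  have : Module.Finite F (AdjoinRoot p) := (AdjoinRoot.powerBasis hp.ne_zero).finite
  have hdim : ∀ k, Module.finrank F (Fin k → AdjoinRoot p) = p.natDegree * k := by
    intro k
    rw [Module.finrank_pi_fintype, Finset.sum_const, (AdjoinRoot.powerBasis hp.ne_zero).finrank,
      AdjoinRoot.powerBasis_dim, Finset.card_univ, Fintype.card_fin, smul_eq_mul, mul_comm]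
  have hpairs : ∀ k : ℕ, ∑ A : Module.End F V, (Nat.card {φ : (Fin k → AdjoinRoot p) →ₗ[F] V //
          Function.Injective φ ∧ ∀ w, φ (AdjoinRoot.root p • w) = A (φ w)} : ℂ) =
      Nat.card (Module.End F V) * ∏ i ∈ Finset.range (p.natDegree * k),
          (1 - (Nat.card F : ℂ) ^ i / (Nat.card F : ℂ) ^ Module.finrank F V) := by
    intro k
    have : _root_.Finite (Fin k → AdjoinRoot p) := Module.finite_of_finite F
    have : _root_.Finite ((Fin k → AdjoinRoot p) →ₗ[F] V) :=
      _root_.Finite.of_injective _ DFunLike.coe_injective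
    have := Fintype.ofFinite {φ : (Fin k → AdjoinRoot p) →ₗ[F] V // Function.Injective φ}
    -- Double counting of pairs `(A, φ)`: fixing `φ` first makes the condition on `A` affine.
    have e : (Σ A : Module.End F V, {φ : (Fin k → AdjoinRoot p) →ₗ[F] V //
          Function.Injective φ ∧ ∀ w, φ (AdjoinRoot.root p • w) = A (φ w)}) ≃
        (Σ φ : {φ : (Fin k → AdjoinRoot p) →ₗ[F] V // Function.Injective φ},
          {A : Module.End F V // ∀ w, φ.1 (AdjoinRoot.root p • w) = A (φ.1 w)}) :=
      { toFun := fun x => ⟨⟨x.2.1, x.2.2.1⟩, ⟨x.1, x.2.2.2⟩⟩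
        invFun := fun y => ⟨y.2.1, ⟨y.1.1, y.1.2, y.2.2⟩⟩
        left_inv := fun _ => rfl
        right_inv := fun _ => rfl }
    have hc := Nat.card_congr e
    rw [Nat.card_sigma, Nat.card_sigma] at hc
    have hext : ∀ φ : {φ : (Fin k → AdjoinRoot p) →ₗ[F] V // Function.Injective φ},
        (Nat.card {A : Module.End F V // ∀ w, φ.1 (AdjoinRoot.root p • w) = A (φ.1 w)} : ℂ) =
        Nat.card (Module.End F V) /
          ((Nat.card F : ℂ) ^ Module.finrank F V) ^ (p.natDegree * k) := by
      intro φ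
      have h1 := card_extensions φ.1 φ.2
        (φ.1 ∘ₗ (LinearMap.lsmul (AdjoinRoot p) (Fin k → AdjoinRoot p)
          (AdjoinRoot.root p)).restrictScalars F)
      rw [hdim] at h1
      rw [← h1, mul_div_cancel_right₀ _ (by positivity)]
      rfl
    have hc' := congrArg (Nat.cast : ℕ → ℂ) hc
    push_cast at hc'
    rw [hc', Finset.sum_congr rfl fun φ _ => hext φ, Finset.sum_const, nsmul_eq_mul,
      Finset.card_univ, ← Nat.card_eq_fintype_card, card_injective_linearMap, hdim,
      mul_div_left_comm]
    congr 1
    rw [← Finset.card_range (p.natDegree * k), ← Finset.prod_const, Finset.card_range,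
      ← Finset.prod_div_distrib]
    exact Finset.prod_congr rfl fun i _ => by rw [sub_div, div_self (by positivity)]
  rw [div_eq_iff hE0, Nat.card_eq_fintype_card, Fintype.card_subtype, Finset.card_filter]
  push_cast
  rw [Finset.sum_congr rfl fun A _ => Module.End.indicator_isUnit_aeval p hp A, Finset.sum_comm,
    Finset.sum_mul]
  refine Finset.sum_congr rfl fun k _ => ?_
  rw [← Finset.mul_sum, hpairs, mul_assoc, mul_comm (Nat.card _ : ℂ)]

/-- The proportion of matrices `A` over a finite field with `p(A)` invertible. -/
theorem Matrix.card_isUnit_aeval {F : Type*} [Field F] [Finite F] (p : Polynomial F)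
    (hp : Irreducible p) (n : ℕ) :
    (Nat.card {A : Matrix (Fin n) (Fin n) F // IsUnit (Polynomial.aeval A p)} : ℂ) /
        Nat.card (Matrix (Fin n) (Fin n) F) =
      ∑ k ∈ Finset.range (n + 1), eulerCoeff ((Nat.card F : ℂ) ^ p.natDegree) k *
        ∏ i ∈ Finset.range (p.natDegree * k), (1 - (Nat.card F : ℂ) ^ i / (Nat.card F : ℂ) ^ n) := by
  have h := Module.End.card_isUnit_aeval (V := Fin n → F) p hp
  rw [Module.finrank_fin_fun] at h
  rw [← h, Nat.card_congr (Matrix.toLinAlgEquiv' (R := F) (n := Fin n)).toEquiv]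
  congr 2
  refine Nat.card_congr ((Matrix.toLinAlgEquiv' (R := F) (n := Fin n)).toEquiv.subtypeEquiv ?_)
  intro A
  rw [← isUnit_map_iff (Matrix.toLinAlgEquiv' (R := F) (n := Fin n))]
  simp [← Polynomial.aeval_algHom_apply]

/-! ### Reduction modulo the maximal ideal and Haar measure. -/

theorem subsingleton_matrixCoker_iff {R : Type*} [CommRing R] {n : ℕ} (M : Matrix (Fin n) (Fin n) R) :
    Subsingleton (matrixCoker M) ↔ IsUnit M := by
  rw [Submodule.Quotient.subsingleton_iff, LinearMap.range_eq_top,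
    ← Matrix.mulVec_surjective_iff_isUnit]
  rfl

theorem Polynomial.aeval_mapMatrix {R S : Type*} [CommRing R] [CommRing S] (f : R →+* S) {n : ℕ}
    (P : Polynomial R) (A : Matrix (Fin n) (Fin n) R) :
    Polynomial.aeval (f.mapMatrix A) (P.map f) = f.mapMatrix (Polynomial.aeval A P) := by
  induction P using Polynomial.induction_on' with
  | add p q hp hq => simp only [Polynomial.map_add, map_add, hp, hq]
  | monomial k a =>
    rw [Polynomial.map_monomial, Polynomial.aeval_monomial, Polynomial.aeval_monomial, map_mul,
      map_pow]
    congr 1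
    ext i j
    simp [Matrix.algebraMap_matrix_apply, apply_ite f]

/-- Vanishing of the cokernel of `P(A)` only depends on `A` modulo the maximal ideal. -/
theorem mem_cokerZeroEvent_iff {R : Type*} [CommRing R] [IsLocalRing R] (P : Polynomial R) {n : ℕ}
    (A : Matrix (Fin n) (Fin n) R) :
    A ∈ cokerZeroEvent P n ↔
      IsUnit (Polynomial.aeval ((IsLocalRing.residue R).mapMatrix A)
        (P.map (IsLocalRing.residue R))) := by
  -- The determinant tests invertibility on both sides, and the residue map of a local ring reflects
  -- units.
  rw [Polynomial.aeval_mapMatrix, Matrix.isUnit_iff_isUnit_det, ← RingHom.map_det,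
    isUnit_map_iff, ← Matrix.isUnit_iff_isUnit_det, ← subsingleton_matrixCoker_iff]
  rfl

/-- An invariant probability measure gives the preimage of a set under a surjection to a finite
group the proportion of that set. -/
theorem MeasureTheory.measure_preimage_of_finite_quotient {G H : Type*} [AddCommGroup G] [AddCommGroup H]
    [MeasurableSpace G] [Finite H] (μ : MeasureTheory.Measure G) [MeasureTheory.IsProbabilityMeasure μ]
    [μ.IsAddLeftInvariant] [MeasurableAdd G] (π : G →+ H) (hπ : Function.Surjective π)
    (hm : ∀ h : H, MeasurableSet (π ⁻¹' {h})) (S : Set H) :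
    MeasurableSet (π ⁻¹' S) ∧ (μ (π ⁻¹' S)).toReal = (Nat.card S : ℝ) / Nat.card H := by
  classical
  have := Fintype.ofFinite H
  have hU : ∀ S : Set H, π ⁻¹' S = ⋃ h ∈ S.toFinset, π ⁻¹' {h} := by
    intro S; ext x; simp
  -- All fibres are translates of one another, so they have equal measure.
  have hfib : ∀ h, μ.real (π ⁻¹' {h}) = μ.real (π ⁻¹' {0}) := by
    intro h
    obtain ⟨g, rfl⟩ := hπ h
    have := MeasureTheory.measure_preimage_add μ g (π ⁻¹' {π g})
    rw [MeasureTheory.measureReal_def, MeasureTheory.measureReal_def, ← this]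
    congr 2
    ext x
    simp
  have hS : ∀ S : Set H, μ.real (π ⁻¹' S) = Nat.card S * μ.real (π ⁻¹' {0}) := by
    intro S
    rw [hU, MeasureTheory.measureReal_biUnion_finset]
    · rw [Finset.sum_congr rfl fun h _ => hfib h, Finset.sum_const, nsmul_eq_mul,
        Set.toFinset_card, Nat.card_eq_fintype_card]
    · intro a _ b _ hab
      exact Disjoint.preimage _ (by simpa using hab)
    · exact fun h _ => hm h
  refine ⟨?_, ?_⟩
  · rw [hU]
    exact Finset.measurableSet_biUnion _ fun h _ => hm h
  · have h1 := hS Set.univ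
    rw [Set.preimage_univ, MeasureTheory.probReal_univ, Nat.card_univ] at h1
    have hne : (Nat.card H : ℝ) ≠ 0 := by exact_mod_cast Nat.card_pos.ne'
    have := hS S
    rw [MeasureTheory.measureReal_def] at this
    rw [this, eq_div_iff hne, mul_assoc, mul_comm (μ.real _), ← h1, mul_one]

theorem isOpen_mapMatrix_residue_preimage {R : Type*} [CommRing R] [IsLocalRing R] (n : ℕ)
    (B : Matrix (Fin n) (Fin n) (IsLocalRing.ResidueField R)) :
    @IsOpen _ (matrixAdicTopology R n) ((IsLocalRing.residue R).mapMatrix ⁻¹' {B}) := by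
  let : WithIdeal R := ⟨IsLocalRing.maximalIdeal R⟩
  have hI : IsAdic (IsLocalRing.maximalIdeal R) := rfl
  have hres : ∀ x : IsLocalRing.ResidueField R, IsOpen ((IsLocalRing.residue R) ⁻¹' {x}) := by
    intro x
    obtain ⟨r, rfl⟩ := IsLocalRing.residue_surjective x
    have h1 : IsOpen ((IsLocalRing.maximalIdeal R : Ideal R) : Set R) := by
      simpa using (isAdic_iff.mp hI).1 1
    have : (IsLocalRing.residue R) ⁻¹' {IsLocalRing.residue R r} =
        (fun y => y - r) ⁻¹' ((IsLocalRing.maximalIdeal R : Ideal R) : Set R) := by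
      ext y
      rw [Set.mem_preimage, Set.mem_singleton_iff, ← sub_eq_zero, ← map_sub,
        IsLocalRing.residue_eq_zero_iff]
      rfl
    rw [this]
    exact h1.preimage (by fun_prop)
  have h2 : (IsLocalRing.residue R).mapMatrix ⁻¹' {B} =
      ⋂ i : Fin n, ⋂ j : Fin n,
        (fun A : Matrix (Fin n) (Fin n) R => A i j) ⁻¹' ((IsLocalRing.residue R) ⁻¹' {B i j}) := by
    ext A
    simp [← Matrix.ext_iff]
  rw [h2]
  exact isOpen_iInter_of_finite fun i => isOpen_iInter_of_finite fun j =>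
    (hres (B i j)).preimage (by fun_prop)

/-- The event is measurable, and its probability is the proportion of its reduction. -/
theorem haarMatrix_cokerZeroEvent {R : Type*} [CommRing R] [IsDomain R] [IsDiscreteValuationRing R]
    [IsAdicComplete (IsLocalRing.maximalIdeal R) R] [Finite (IsLocalRing.ResidueField R)]
    (P : Polynomial R) (n : ℕ) :
    @MeasurableSet _ (matrixBorel R n) (cokerZeroEvent P n) ∧
      (haarMatrix R n (cokerZeroEvent P n)).toReal =
        (Nat.card {A : Matrix (Fin n) (Fin n) (IsLocalRing.ResidueField R) //
          IsUnit (Polynomial.aeval A (P.map (IsLocalRing.residue R)))} : ℝ) /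
        Nat.card (Matrix (Fin n) (Fin n) (IsLocalRing.ResidueField R)) := by
  let := matrixAdicTopology R n
  let := matrixBorel R n
  have : BorelSpace (Matrix (Fin n) (Fin n) R) := ⟨rfl⟩
  have := matrixAdicTopology_isTopologicalAddGroup R n
  have := matrixAdicTopology_compactSpace R n
  have hprob : MeasureTheory.IsProbabilityMeasure (haarMatrix R n) :=
    ⟨MeasureTheory.Measure.addHaarMeasure_self (K₀ := ⊤)⟩
  have hinv : (haarMatrix R n).IsAddLeftInvariant :=
    inferInstanceAs (MeasureTheory.Measure.addHaarMeasure ⊤).IsAddLeftInvariant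
  have hset : cokerZeroEvent P n =
      ((IsLocalRing.residue R).mapMatrix : _ →+* Matrix (Fin n) (Fin n) _).toAddMonoidHom ⁻¹'
        {A | IsUnit (Polynomial.aeval A (P.map (IsLocalRing.residue R)))} := by
    ext A
    exact mem_cokerZeroEvent_iff P A
  have hsurj : Function.Surjective
      ((IsLocalRing.residue R).mapMatrix : _ →+* Matrix (Fin n) (Fin n) _).toAddMonoidHom := by
    intro B
    choose f hf using IsLocalRing.residue_surjective (R := R)
    exact ⟨B.map f, by ext i j; simp [hf]⟩
  rw [hset]
  have : Finite (Matrix (Fin n) (Fin n) (IsLocalRing.ResidueField R)) :=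
    inferInstanceAs (Finite (Fin n → Fin n → _))
  exact MeasureTheory.measure_preimage_of_finite_quotient (haarMatrix R n) _ hsurj
    (fun B => (isOpen_mapMatrix_residue_preimage n B).measurableSet) _

/-! ### Infinite products and a functional equation in power series. -/

namespace PowerSeries

/-- The sum of the norms of the coefficients of degree at most `N`. -/
noncomputable def truncNorm {K : Type*} [NormedField K] (N : ℕ) (f : PowerSeries K) : ℝ :=
  ∑ j ∈ Finset.range (N + 1), ‖coeff j f‖

theorem truncNorm_nonneg {K : Type*} [NormedField K] (N : ℕ) (f : PowerSeries K) :
    0 ≤ truncNorm N f :=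
  Finset.sum_nonneg fun _ _ => norm_nonneg _

theorem norm_coeff_le_truncNorm {K : Type*} [NormedField K] (N : ℕ) (f : PowerSeries K) :
    ‖coeff N f‖ ≤ truncNorm N f :=
  Finset.single_le_sum (f := fun j => ‖coeff j f‖) (fun _ _ => norm_nonneg _)
    (Finset.self_mem_range_succ N)

theorem truncNorm_one {K : Type*} [NormedField K] (N : ℕ) :
    truncNorm N (1 : PowerSeries K) = 1 := by
  rw [truncNorm, Finset.sum_eq_single 0] <;> simp +contextual [coeff_one]

/-- The pairs of degrees with sum at most `N` lie in the square `[0, N]²`, and the antidiagonals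
they form are disjoint. -/
theorem truncNorm_mul_le {K : Type*} [NormedField K] (N : ℕ) (f g : PowerSeries K) :
    truncNorm N (f * g) ≤ truncNorm N f * truncNorm N g := by
  simp only [truncNorm, Finset.sum_mul_sum, coeff_mul]
  rw [← Finset.sum_product']
  calc ∑ j ∈ Finset.range (N + 1), ‖∑ x ∈ Finset.HasAntidiagonal.antidiagonal j, coeff x.1 f * coeff x.2 g‖
      ≤ ∑ j ∈ Finset.range (N + 1), ∑ x ∈ Finset.HasAntidiagonal.antidiagonal j, ‖coeff x.1 f‖ * ‖coeff x.2 g‖ :=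
        Finset.sum_le_sum fun j _ => (norm_sum_le _ _).trans_eq
          (Finset.sum_congr rfl fun x _ => norm_mul _ _)
    _ = ∑ x ∈ (Finset.range (N + 1)).biUnion Finset.HasAntidiagonal.antidiagonal, ‖coeff x.1 f‖ * ‖coeff x.2 g‖ := by
        rw [Finset.sum_biUnion]
        intro a _ b _ hab
        refine Finset.disjoint_left.mpr fun x hx hx' => hab ?_
        rw [Finset.HasAntidiagonal.mem_antidiagonal] at hx hx'
        exact hx.symm.trans hx'
    _ ≤ _ := by
        refine Finset.sum_le_sum_of_subset_of_nonneg ?_ fun _ _ _ => by positivity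
        intro x hx
        simp only [Finset.mem_biUnion, Finset.mem_range, Finset.HasAntidiagonal.mem_antidiagonal,
          Finset.mem_product] at hx ⊢
        omega

theorem truncNorm_prod_le {K ι : Type*} [NormedField K] (N : ℕ) (f : ι → PowerSeries K)
    (s : Finset ι) : truncNorm N (∏ i ∈ s, f i) ≤ ∏ i ∈ s, truncNorm N (f i) := by
  classical
  induction s using Finset.induction_on with
  | empty => simp [truncNorm_one]
  | insert a s ha ih =>
    rw [Finset.prod_insert ha, Finset.prod_insert ha]
    exact (truncNorm_mul_le _ _ _).trans (mul_le_mul_of_nonneg_left ih (truncNorm_nonneg _ _))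

/-- The product expands into a sum of `∏_{i ∈ s} f i` over finite sets `s`. Submultiplicativity
makes each coefficient of this sum absolutely summable. -/
theorem multipliable_one_add_of_summable_truncNorm {K ι : Type*} [NormedField K] [CompleteSpace K]
    (f : ι → PowerSeries K) (h : ∀ N, Summable fun i => truncNorm N (f i)) :
    Multipliable fun i => 1 + f i := by
  refine multipliable_one_add_of_summable_prod ?_
  rw [WithPiTopology.summable_iff_summable_coeff]
  intro N
  refine Summable.of_norm_bounded
    (summable_finsetProd_of_summable_nonneg (fun i => truncNorm_nonneg N (f i)) (h N)) fun s => ?_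
  exact (norm_coeff_le_truncNorm _ _).trans (truncNorm_prod_le _ _ _)

theorem continuous_rescale {K : Type*} [CommSemiring K] [TopologicalSpace K] [IsTopologicalSemiring K]
    (r : K) : Continuous (rescale r : PowerSeries K →+* PowerSeries K) := by
  rw [continuous_iff_continuousAt]
  intro f
  refine (WithPiTopology.tendsto_iff_coeff_tendsto K _ _ _).mpr fun n => ?_
  simp only [coeff_rescale]
  exact (((WithPiTopology.continuous_coeff K n).const_mul (r ^ n)).tendsto f)

theorem one_sub_C_mul_X_inv {K : Type*} [Field K] (b : K) :
    (1 - C b * X : PowerSeries K)⁻¹ = mk fun n => b ^ n := by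
  rw [PowerSeries.inv_eq_iff_mul_eq_one (by simp)]
  have := congrArg (rescale b) (mk_one_mul_one_sub_eq_one K)
  rw [map_mul, map_sub, map_one, rescale_X] at this
  refine Eq.trans ?_ this
  congr 1
  ext n
  simp [coeff_rescale]

/-- Uniqueness of solutions of `(1 - u) f(u) = (1 - (r u)^d) f(r u)` with given constant term. -/
theorem eq_of_one_sub_mul_eq_rescale {K : Type*} [Field K] (r : K) (hr : ∀ n : ℕ, 1 - r ^ (n + 1) ≠ 0)
    {d : ℕ} (hd : d ≠ 0) {f g : PowerSeries K}
    (hf : (1 - X) * f = (1 - (C r * X) ^ d) * rescale r f)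
    (hg : (1 - X) * g = (1 - (C r * X) ^ d) * rescale r g)
    (h0 : coeff 0 f = coeff 0 g) : f = g := by
  have hh : (1 - X) * (f - g) = (1 - (C r * X) ^ d) * rescale r (f - g) := by
    rw [mul_sub, hf, hg, map_sub, mul_sub]
  have hu0 : coeff 0 (f - g) = 0 := by rw [map_sub, h0, sub_self]
  rw [← sub_eq_zero]
  generalize f - g = u at hh hu0 ⊢
  ext n
  rw [map_zero]
  induction n using Nat.strong_induction_on with
  | _ n ih =>
    rcases n with _ | n
    · exact hu0
    · have h := congrArg (coeff (n + 1)) hh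
      rw [sub_mul, sub_mul, one_mul, one_mul, map_sub, map_sub, coeff_succ_X_mul,
        ih n (Nat.lt_succ_self n), mul_pow, ← map_pow, mul_assoc, coeff_C_mul, coeff_X_pow_mul',
        coeff_rescale] at h
      -- As `d ≠ 0`, this coefficient has degree below `n + 1` and vanishes by induction; degree `n
      -- + 1` then reads `(1 - r^(n+1)) u_{n+1} = 0`.
      have h2 : (if d ≤ n + 1 then coeff (n + 1 - d) (rescale r u) else 0) = 0 := by
        split_ifs with hdn
        · rw [coeff_rescale, ih _ (by omega), mul_zero]
        · rfl
      rw [h2, mul_zero, sub_zero, sub_zero] at h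
      have h3 : (1 - r ^ (n + 1)) * coeff (n + 1) u = 0 := by
        rw [sub_mul, ← h, one_mul, sub_self]
      exact (mul_eq_zero.mp h3).resolve_left (hr n)

end PowerSeries

/-! ### The generating product and its functional equation. -/

open PowerSeries in
theorem bFactor_succ (q d i : ℕ) :
    bFactor q d (i + 1) = (1 - (C (((q : ℂ)⁻¹) ^ (i + 1)) * X) ^ d) *
      mk fun n => ((((q : ℂ)⁻¹) ^ i) ^ n) := by
  rw [bFactor, one_sub_C_mul_X_inv]
  have h1 : (q : ℂ) ^ (-((i + 1 : ℕ) : ℤ)) = ((q : ℂ)⁻¹) ^ (i + 1) := by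
    rw [zpow_neg, zpow_natCast, inv_pow]
  have h2 : (q : ℂ) ^ (1 - ((i + 1 : ℕ) : ℤ)) = ((q : ℂ)⁻¹) ^ i := by
    rw [show (1 - ((i + 1 : ℕ) : ℤ)) = -(i : ℤ) by push_cast; ring, zpow_neg, zpow_natCast, inv_pow]
  rw [h1, h2]

open PowerSeries in
theorem rescale_bFactor (q d i : ℕ) :
    rescale ((q : ℂ)⁻¹) (bFactor q d (i + 1)) = bFactor q d (i + 1 + 1) := by
  rw [bFactor_succ, bFactor_succ, map_mul, map_sub, map_one, map_pow, map_mul, rescale_X]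
  congr 1
  · have : rescale ((q : ℂ)⁻¹) (C ((q : ℂ)⁻¹ ^ (i + 1))) = C ((q : ℂ)⁻¹ ^ (i + 1)) := by
      ext n; simp only [coeff_rescale, coeff_C]; split_ifs with h <;> simp [h]
    rw [this, ← mul_assoc, ← map_mul, ← pow_succ]
  · rw [rescale_mk]
    ext n
    simp only [coeff_mk]
    rw [← mul_pow, ← pow_succ']

open PowerSeries in
theorem multipliable_bFactor {q : ℕ} (hq : 1 < q) {d : ℕ} (hd : d ≠ 0) :
    Multipliable fun i : ℕ => bFactor q d (i + 1) := by
  have hr1 : ‖(q : ℂ)⁻¹‖ < 1 := by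
    rw [norm_inv, Complex.norm_natCast]
    exact inv_lt_one_of_one_lt₀ (by exact_mod_cast hq)
  -- Each factor is 1 plus (numerator minus denominator) over denominator; that difference has
  -- coefficients of size at most `q^{-i}`, which gives geometric decay in every truncation.
  have key : (fun i : ℕ => bFactor q d (i + 1)) = fun i => 1 +
      (C (((q : ℂ)⁻¹) ^ i) * X - (C (((q : ℂ)⁻¹) ^ (i + 1)) * X) ^ d) *
        mk fun n => ((((q : ℂ)⁻¹) ^ i) ^ n) := by
    funext i
    have h : (1 - C (((q : ℂ)⁻¹) ^ i) * X) * mk (fun n => ((((q : ℂ)⁻¹) ^ i) ^ n)) = 1 := by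
      rw [← one_sub_C_mul_X_inv, PowerSeries.mul_inv_cancel _ (by simp)]
    rw [bFactor_succ]
    linear_combination h
  rw [key]
  refine multipliable_one_add_of_summable_truncNorm _ fun N => ?_
  have hb : ∀ i : ℕ, truncNorm N ((C (((q : ℂ)⁻¹) ^ i) * X - (C (((q : ℂ)⁻¹) ^ (i + 1)) * X) ^ d) *
        mk fun n => ((((q : ℂ)⁻¹) ^ i) ^ n)) ≤
      ‖(q : ℂ)⁻¹‖ ^ i * (((N + 1 : ℕ) : ℝ) * 2 * (N + 1 : ℕ)) := by
    intro i
    set ρ := ‖(q : ℂ)⁻¹‖ with hρ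
    have hρ0 : 0 ≤ ρ := norm_nonneg _
    refine (truncNorm_mul_le _ _ _).trans ?_
    have h1 : truncNorm N (C (((q : ℂ)⁻¹) ^ i) * X - (C (((q : ℂ)⁻¹) ^ (i + 1)) * X) ^ d) ≤
        (N + 1 : ℕ) * (2 * ρ ^ i) := by
      rw [truncNorm, ← nsmul_eq_mul]
      refine (Finset.sum_le_card_nsmul _ _ (2 * ρ ^ i) fun j _ => ?_).trans_eq (by simp)
      rw [map_sub, mul_pow, ← map_pow, coeff_C_mul_X_pow, coeff_C_mul, coeff_X]
      refine (norm_sub_le _ _).trans ?_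
      rw [two_mul]
      refine add_le_add ?_ ?_
      · split_ifs
        · simp [hρ]
        · simp only [mul_zero, norm_zero]; positivity
      · split_ifs
        · rw [norm_pow, norm_pow, ← hρ, ← pow_mul]
          refine pow_le_pow_of_le_one hρ0 hr1.le ?_
          exact (Nat.le_succ i).trans (Nat.le_mul_of_pos_right _ (Nat.pos_of_ne_zero hd))
        · rw [norm_zero]; positivity
    have h2 : truncNorm N (mk fun n => ((((q : ℂ)⁻¹) ^ i) ^ n)) ≤ (N + 1 : ℕ) := by
      rw [truncNorm]
      refine (Finset.sum_le_card_nsmul _ _ 1 fun j _ => ?_).trans_eq (by simp)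
      rw [coeff_mk, norm_pow, norm_pow]
      exact pow_le_one₀ (by positivity) (pow_le_one₀ hρ0 hr1.le)
    refine (mul_le_mul h1 h2 (truncNorm_nonneg _ _) (by positivity)).trans_eq ?_
    ring
  exact Summable.of_nonneg_of_le (fun i => truncNorm_nonneg _ _) hb
    ((summable_geometric_of_lt_one (norm_nonneg _) hr1).mul_right _)

-- Substituting `u/q` for `u` shifts the factors by one index, so the original product is its
-- rescaling times the first factor `(1 - (u/q)^d) / (1 - u)`.
open PowerSeries in
theorem tprod_bFactor_functional {q : ℕ} (hq : 1 < q) {d : ℕ} (hd : d ≠ 0) :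
    (1 - X) * ∏' i : ℕ, bFactor q d (i + 1) =
      (1 - (C ((q : ℂ)⁻¹) * X) ^ d) * rescale ((q : ℂ)⁻¹) (∏' i : ℕ, bFactor q d (i + 1)) := by
  have hm := multipliable_bFactor hq hd
  have hmap := hm.map (rescale ((q : ℂ)⁻¹)) (continuous_rescale _)
  have htp := hm.map_tprod (rescale ((q : ℂ)⁻¹)) (continuous_rescale _)
  have hfun : (rescale ((q : ℂ)⁻¹)) ∘ (fun i : ℕ => bFactor q d (i + 1)) =
      fun i : ℕ => bFactor q d (i + 1 + 1) := by
    funext i; exact rescale_bFactor q d i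
  rw [hfun] at hmap
  simp only [rescale_bFactor] at htp
  rw [htp, tprod_eq_zero_mul' (f := fun i : ℕ => bFactor q d (i + 1)) hmap, bFactor_succ, ← mul_assoc]
  congr 1
  have h : (1 - X) * mk (fun n => ((((q : ℂ)⁻¹) ^ 0) ^ n)) = 1 := by
    rw [← one_sub_C_mul_X_inv]
    simp [PowerSeries.mul_inv_cancel]
  rw [zero_add, pow_one]
  linear_combination (1 - (C ((q : ℂ)⁻¹) * X) ^ d) * h

open PowerSeries in
theorem coeff_zero_tprod_bFactor {q : ℕ} (hq : 1 < q) {d : ℕ} (hd : d ≠ 0) :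
    coeff 0 (∏' i : ℕ, bFactor q d (i + 1)) = 1 := by
  rw [coeff_zero_eq_constantCoeff_apply, (multipliable_bFactor hq hd).map_tprod constantCoeff
    (WithPiTopology.continuous_constantCoeff ℂ)]
  refine (tprod_congr fun i => ?_).trans tprod_one
  rw [bFactor]
  simp [hd]

/-! ### Explicit coefficients of the product. -/

section GeneratingFunction

variable {q : ℕ} {d : ℕ}

theorem inv_natCast_norm_lt_one (hq : 1 < q) : ‖(q : ℂ)⁻¹‖ < 1 := by
  rw [norm_inv, Complex.norm_natCast]
  exact inv_lt_one_of_one_lt₀ (by exact_mod_cast hq)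

theorem one_sub_inv_natCast_pow_ne_zero (hq : 1 < q) (n : ℕ) : 1 - ((q : ℂ)⁻¹) ^ (n + 1) ≠ 0 := by
  intro h
  have h1 : ‖((q : ℂ)⁻¹) ^ (n + 1)‖ < 1 := by
    rw [norm_pow]
    exact pow_lt_one₀ (norm_nonneg _) (inv_natCast_norm_lt_one hq) n.succ_ne_zero
  rw [← sub_eq_zero.mp h, norm_one] at h1
  exact lt_irrefl _ h1

/-- The coefficients of `∏_{i ≥ 1} (1 - (q^{-i} u)^d)`. -/
noncomputable def sparseEulerCoeff (q d m : ℕ) : ℂ :=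
  if d ∣ m then eulerCoeff ((q : ℂ) ^ d) (m / d) else 0

/-- The coefficients of `∏_{i ≥ 0} 1 / (1 - q^{-i} u)`. -/
noncomputable def eulerInvCoeff (q n : ℕ) : ℂ :=
  ∏ j ∈ Finset.range n, (1 - ((q : ℂ)⁻¹) ^ (j + 1))⁻¹

theorem sparseEulerCoeff_zero : sparseEulerCoeff q d 0 = 1 := by
  simp [sparseEulerCoeff, eulerCoeff]

/-- This is `E(u) = (1 - (u/q)^d) E(u/q)` read off in degree `m`, for `E` the series with these
coefficients. -/
theorem sparseEulerCoeff_recurrence (hq : 1 < q) (hd : d ≠ 0) (m : ℕ) :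
    sparseEulerCoeff q d m = ((q : ℂ)⁻¹) ^ m *
      (sparseEulerCoeff q d m - if d ≤ m then sparseEulerCoeff q d (m - d) else 0) := by
  have hq0 : (q : ℂ) ≠ 0 := by exact_mod_cast (by omega : q ≠ 0)
  by_cases h : d ∣ m
  · obtain ⟨k, rfl⟩ := h
    rcases k with _ | k
    · simp [hd]
    · have h1 : d ≤ d * (k + 1) := Nat.le_mul_of_pos_right _ k.succ_pos
      have h2 : d * (k + 1) - d = d * k := by rw [mul_add, mul_one, Nat.add_sub_cancel]
      have hne := one_sub_inv_natCast_pow_ne_zero hq (d * (k + 1) - 1)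
      rw [Nat.sub_add_cancel (Nat.mul_pos (Nat.pos_of_ne_zero hd) k.succ_pos)] at hne
      have hne' : ((q : ℂ) ^ d) ^ (k + 1) - 1 ≠ 0 := by
        intro h0
        apply hne
        rw [inv_pow, pow_mul, sub_eq_zero.mp h0, inv_one, sub_self]
      rw [if_pos h1, h2, sparseEulerCoeff, if_pos (Dvd.intro _ rfl), sparseEulerCoeff,
        if_pos (Dvd.intro _ rfl), Nat.mul_div_cancel_left _ (Nat.pos_of_ne_zero hd),
        Nat.mul_div_cancel_left _ (Nat.pos_of_ne_zero hd), eulerCoeff_succ, inv_pow, pow_mul]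
      field_simp
      ring
  · rw [sparseEulerCoeff, if_neg h]
    split_ifs with h1
    · rw [sparseEulerCoeff, if_neg (fun h2 => h ((Nat.dvd_sub_iff_left h1 dvd_rfl).mp h2))]
      simp
    · simp

-- Both sides have constant term 1 and satisfy the same functional equation: the numerator series
-- contributes `1 - (u/q)^d` and the denominator series contributes `1 - u`.
open PowerSeries in
theorem tprod_bFactor_eq (hq : 1 < q) (hd : d ≠ 0) :
    ∏' i : ℕ, bFactor q d (i + 1) = mk (sparseEulerCoeff q d) * mk (eulerInvCoeff q) := by
  have hE : mk (sparseEulerCoeff q d) =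
      (1 - (C ((q : ℂ)⁻¹) * X) ^ d) * rescale ((q : ℂ)⁻¹) (mk (sparseEulerCoeff q d)) := by
    ext m
    rw [sub_mul, one_mul, map_sub, mul_pow, ← map_pow, mul_assoc, coeff_C_mul, coeff_X_pow_mul',
      coeff_rescale, coeff_rescale, coeff_mk, coeff_mk]
    refine (sparseEulerCoeff_recurrence hq hd m).trans ?_
    split_ifs with h
    · rw [← mul_assoc, ← pow_add, Nat.add_sub_cancel' h, mul_sub]
    · simp
  have hC : (1 - X) * mk (eulerInvCoeff q) = rescale ((q : ℂ)⁻¹) (mk (eulerInvCoeff q)) := by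
    ext m
    rw [sub_mul, one_mul, map_sub, coeff_rescale, coeff_mk]
    rcases m with _ | m
    · simp
    · rw [coeff_succ_X_mul, coeff_mk, eulerInvCoeff, eulerInvCoeff, Finset.prod_range_succ]
      linear_combination (∏ j ∈ Finset.range m, (1 - ((q : ℂ)⁻¹) ^ (j + 1))⁻¹) *
        mul_inv_cancel₀ (one_sub_inv_natCast_pow_ne_zero hq m)
  refine eq_of_one_sub_mul_eq_rescale _ (one_sub_inv_natCast_pow_ne_zero hq) hd
    (tprod_bFactor_functional hq hd) ?_ ?_
  · rw [mul_left_comm, hC, map_mul]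
    nth_rewrite 1 [hE]
    ring
  · rw [coeff_zero_tprod_bFactor hq hd]
    simp [sparseEulerCoeff_zero, eulerInvCoeff]

theorem bCoeff_eq (hq : 1 < q) (hd : d ≠ 0) (n : ℕ) :
    bCoeff q n d =
      ∑ m ∈ Finset.range (n + 1), sparseEulerCoeff q d m * eulerInvCoeff q (n - m) := by
  rw [bCoeff, tprod_bFactor_eq hq hd, PowerSeries.coeff_mul,
    Finset.Nat.sum_antidiagonal_eq_sum_range_succ_mk]
  simp

theorem eulerInvCoeff_mul_prod (hq : 1 < q) {n m : ℕ} (h : m ≤ n) :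
    eulerInvCoeff q (n - m) * ∏ j ∈ Finset.range n, (1 - ((q : ℂ)⁻¹) ^ (j + 1)) =
      ∏ i ∈ Finset.range m, (1 - (q : ℂ) ^ i / (q : ℂ) ^ n) := by
  have hq0 : (q : ℂ) ≠ 0 := by exact_mod_cast (by omega : q ≠ 0)
  obtain ⟨l, rfl⟩ := Nat.exists_eq_add_of_le' h
  rw [Nat.add_sub_cancel, Finset.prod_range_add, ← mul_assoc, eulerInvCoeff,
    ← Finset.prod_mul_distrib, Finset.prod_eq_one fun j _ =>
      inv_mul_cancel₀ (one_sub_inv_natCast_pow_ne_zero hq j), one_mul,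
    ← Finset.prod_range_reflect]
  refine Finset.prod_congr rfl fun i hi => ?_
  rw [Finset.mem_range] at hi
  -- After reflection the `i`-th factor has exponent `l + (m - 1 - i) + 1 = n - i`, where `n = l +
  -- m`.
  rw [inv_pow, div_eq_mul_inv, eq_comm, show l + m = i + (l + (m - 1 - i) + 1) by omega, pow_add]
  congr 1
  field_simp

/-- The right side is the proportion found over the finite field. The convolution is supported on `m
= d * k`, and each of its terms becomes the `k`-th summand. -/
theorem bCoeff_mul_prod (hq : 1 < q) (hd : d ≠ 0) (n : ℕ) :
    bCoeff q n d * ∏ j ∈ Finset.range n, (1 - ((q : ℂ)⁻¹) ^ (j + 1)) =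
      ∑ k ∈ Finset.range (n + 1), eulerCoeff ((q : ℂ) ^ d) k *
        ∏ i ∈ Finset.range (d * k), (1 - (q : ℂ) ^ i / (q : ℂ) ^ n) := by
  have hq0 : (q : ℂ) ≠ 0 := by exact_mod_cast (by omega : q ≠ 0)
  -- For `d * k > n` the factor `i = n` is `1 - 1 = 0`, so only the `k` matched by some `m ≤ n`
  -- remain.
  have h1 : ∀ k ∈ Finset.range (n + 1), eulerCoeff ((q : ℂ) ^ d) k *
      ∏ i ∈ Finset.range (d * k), (1 - (q : ℂ) ^ i / (q : ℂ) ^ n) ≠ 0 → d * k ≤ n := by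
    intro k _ h
    by_contra! hlt
    refine h (mul_eq_zero_of_right _ (Finset.prod_eq_zero (Finset.mem_range.mpr hlt) ?_))
    rw [div_self (by positivity), sub_self]
  rw [bCoeff_eq hq hd, Finset.sum_mul, ← Finset.sum_filter_of_ne h1]
  have h2 : ∀ m ∈ Finset.range (n + 1), sparseEulerCoeff q d m * eulerInvCoeff q (n - m) *
      ∏ j ∈ Finset.range n, (1 - ((q : ℂ)⁻¹) ^ (j + 1)) ≠ 0 → d ∣ m := by
    intro m _ h
    by_contra hm
    exact h (by rw [sparseEulerCoeff, if_neg hm, zero_mul, zero_mul])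
  rw [← Finset.sum_filter_of_ne h2]
  have hd' := Nat.pos_of_ne_zero hd
  refine Finset.sum_nbij' (fun m => m / d) (fun k => d * k) ?_ ?_ ?_ ?_ ?_
  · intro m hm
    simp only [Finset.mem_filter, Finset.mem_range] at hm ⊢
    rw [Nat.mul_div_cancel' hm.2]
    exact ⟨(Nat.div_le_self _ _).trans_lt hm.1, Nat.lt_succ_iff.mp hm.1⟩
  · intro k hk
    simp only [Finset.mem_filter, Finset.mem_range] at hk ⊢
    exact ⟨Nat.lt_succ_of_le hk.2, Dvd.intro _ rfl⟩
  · intro m hm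
    exact Nat.mul_div_cancel' (Finset.mem_filter.mp hm).2
  · intro k _
    exact Nat.mul_div_cancel_left _ hd'
  · intro m hm
    simp only [Finset.mem_filter, Finset.mem_range] at hm
    rw [mul_assoc, eulerInvCoeff_mul_prod hq (Nat.lt_succ_iff.mp hm.1), sparseEulerCoeff,
      if_pos hm.2, Nat.mul_div_cancel' hm.2]

/-! ### Bounds, convergence and limits. -/

/-- The constant 2 pays for the first denominator, `1/(Q - 1) ≤ 2/Q`; every later denominator
`Q^(k+2) - 1` is at least `Q`. -/
theorem norm_eulerCoeff_le {Q : ℕ} (hQ : 2 ≤ Q) (k : ℕ) :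
    ‖eulerCoeff (Q : ℂ) k‖ ≤ 2 * ((Q : ℝ)⁻¹) ^ k := by
  have hQ' : (2 : ℝ) ≤ Q := by exact_mod_cast hQ
  have hnorm : ∀ k : ℕ, ‖((Q : ℂ) ^ (k + 1) - 1)‖ = (Q : ℝ) ^ (k + 1) - 1 := by
    intro k
    have h1 : (1 : ℝ) ≤ (Q : ℝ) ^ (k + 1) := one_le_pow₀ (by linarith)
    have : ((Q : ℂ) ^ (k + 1) - 1) = (((Q : ℝ) ^ (k + 1) - 1 : ℝ) : ℂ) := by push_cast; rfl
    rw [this, Complex.norm_real, Real.norm_of_nonneg (by linarith)]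
  have hpow : ∀ k : ℕ, (Q : ℝ) ≤ (Q : ℝ) ^ (k + 1) := fun k => by
    simpa using pow_le_pow_right₀ (by linarith : (1 : ℝ) ≤ Q) (Nat.le_add_left 1 k)
  induction k with
  | zero => simp [eulerCoeff]
  | succ k ih =>
    rw [eulerCoeff_succ, norm_div, norm_neg, hnorm, div_le_iff₀ (by linarith [hpow k])]
    rcases k with _ | k
    · have h0 : ‖eulerCoeff (Q : ℂ) 0‖ = 1 := by simp [eulerCoeff]
      rw [h0]
      have : (Q : ℝ)⁻¹ ≤ 1 / 2 := by rw [inv_le_comm₀] <;> norm_num <;> linarith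
      have h3 : (Q : ℝ)⁻¹ * Q = 1 := inv_mul_cancel₀ (by linarith)
      simp only [zero_add, pow_one]
      nlinarith
    · refine ih.trans ?_
      rw [pow_succ _ (k + 1), mul_assoc, mul_assoc]
      refine mul_le_mul_of_nonneg_left (le_mul_of_one_le_right (by positivity) ?_) zero_le_two
      rw [inv_mul_eq_div, one_le_div (by linarith), pow_succ]
      nlinarith [hpow k]

theorem norm_sparseEulerCoeff_le (hq : 1 < q) (hd : d ≠ 0) (m : ℕ) :
    ‖sparseEulerCoeff q d m‖ ≤ 2 * ‖(q : ℂ)⁻¹‖ ^ m := by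
  rw [sparseEulerCoeff]
  split_ifs with h
  · obtain ⟨k, rfl⟩ := h
    rw [Nat.mul_div_cancel_left _ (Nat.pos_of_ne_zero hd)]
    have h2 : 2 ≤ q ^ d := by
      calc 2 ≤ q := hq
        _ = q ^ 1 := (pow_one q).symm
        _ ≤ q ^ d := Nat.pow_le_pow_right (by omega) (Nat.pos_of_ne_zero hd)
    have := norm_eulerCoeff_le h2 k
    rw [norm_inv, Complex.norm_natCast, pow_mul, inv_pow]
    exact_mod_cast this
  · rw [norm_zero]; positivity

theorem summable_norm_sparseEulerCoeff (hq : 1 < q) (hd : d ≠ 0) :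
    Summable fun m => ‖sparseEulerCoeff q d m‖ :=
  Summable.of_nonneg_of_le (fun _ => norm_nonneg _) (norm_sparseEulerCoeff_le hq hd)
    ((summable_geometric_of_lt_one (norm_nonneg _) (inv_natCast_norm_lt_one hq)).mul_left 2)

theorem multipliable_one_sub_inv_pow_pow {𝕜 : Type*} [RCLike 𝕜] (hq : 1 < q) (hd : d ≠ 0) :
    Multipliable fun i : ℕ => 1 - (((q : 𝕜)⁻¹) ^ (i + 1)) ^ d := by
  have hr : ‖(q : 𝕜)⁻¹‖ < 1 := by
    rw [norm_inv, RCLike.norm_natCast]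
    exact inv_lt_one_of_one_lt₀ (by exact_mod_cast hq)
  simp only [sub_eq_add_neg]
  refine multipliable_one_add_of_summable ?_
  refine Summable.of_nonneg_of_le (fun _ => norm_nonneg _) (fun i => ?_)
    (summable_geometric_of_lt_one (norm_nonneg _) hr)
  rw [norm_neg, ← pow_mul, norm_pow]
  exact pow_le_pow_of_le_one (norm_nonneg _) hr.le
    ((Nat.le_succ i).trans (Nat.le_mul_of_pos_right _ (Nat.pos_of_ne_zero hd)))

theorem multipliable_one_sub_inv_pow_inv (hq : 1 < q) :
    Multipliable fun i : ℕ => (1 - ((q : ℂ)⁻¹) ^ (i + 1))⁻¹ := by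
  have hr := inv_natCast_norm_lt_one hq
  have h : (fun i : ℕ => (1 - ((q : ℂ)⁻¹) ^ (i + 1))⁻¹) =
      fun i => 1 + ((q : ℂ)⁻¹) ^ (i + 1) * (1 - ((q : ℂ)⁻¹) ^ (i + 1))⁻¹ := by
    funext i
    linear_combination mul_inv_cancel₀ (one_sub_inv_natCast_pow_ne_zero hq i)
  rw [h]
  refine multipliable_one_add_of_summable ?_
  refine Summable.of_nonneg_of_le (fun _ => norm_nonneg _) (fun i => ?_)
    ((summable_geometric_of_lt_one (norm_nonneg _) hr).mul_right (1 - ‖(q : ℂ)⁻¹‖)⁻¹)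
  rw [norm_mul, norm_pow, norm_inv (1 - _)]
  have h1 : ‖(q : ℂ)⁻¹‖ ^ (i + 1) ≤ ‖(q : ℂ)⁻¹‖ := by
    simpa using pow_le_pow_of_le_one (norm_nonneg _) hr.le (Nat.le_add_left 1 i)
  have h2 : 1 - ‖(q : ℂ)⁻¹‖ ≤ ‖1 - ((q : ℂ)⁻¹) ^ (i + 1)‖ := by
    refine le_trans ?_ (norm_sub_norm_le _ _)
    rw [norm_one, norm_pow]
    linarith
  exact mul_le_mul (pow_le_pow_of_le_one (norm_nonneg _) hr.le (Nat.le_succ i))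
    (inv_anti₀ (by linarith) h2) (by positivity) (by positivity)

/-- Euler's identity at `u = 1`. -/
theorem tsum_sparseEulerCoeff (hq : 1 < q) (hd : d ≠ 0) :
    ∑' m, sparseEulerCoeff q d m = ∏' i : ℕ, (1 - (((q : ℂ)⁻¹) ^ (i + 1)) ^ d) := by
  have hr := inv_natCast_norm_lt_one hq
  have hsum := summable_norm_sparseEulerCoeff hq hd
  have hbound : ∀ t m : ℕ, ‖sparseEulerCoeff q d m * (((q : ℂ)⁻¹) ^ t) ^ m‖ ≤
      ‖sparseEulerCoeff q d m‖ := by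
    intro t m
    rw [norm_mul, norm_pow, norm_pow]
    exact mul_le_of_le_one_right (norm_nonneg _)
      (pow_le_one₀ (by positivity) (pow_le_one₀ (norm_nonneg _) hr.le))
  have hS : ∀ t : ℕ, Summable fun m => sparseEulerCoeff q d m * (((q : ℂ)⁻¹) ^ t) ^ m :=
    fun t => Summable.of_norm_bounded hsum (hbound t)
  -- `S t` is the value `E(q^{-t})` of the series with coefficients `sparseEulerCoeff`. Iterating
  -- its functional equation from `S 0`, with `S t → E(0) = 1`, produces the product.
  let S : ℕ → ℂ := fun t => ∑' m, sparseEulerCoeff q d m * (((q : ℂ)⁻¹) ^ t) ^ m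
  have hrec : ∀ t, S t = (1 - (((q : ℂ)⁻¹) ^ (t + 1)) ^ d) * S (t + 1) := by
    intro t
    -- The terms of `(u/q)^d E(u/q)` at `u = q^{-t}`, indexed by total degree.
    let G : ℕ → ℂ := fun m =>
      if d ≤ m then sparseEulerCoeff q d (m - d) * (((q : ℂ)⁻¹) ^ (t + 1)) ^ m else 0
    have hGd : ∀ m, G (m + d) =
        (((q : ℂ)⁻¹) ^ (t + 1)) ^ d * (sparseEulerCoeff q d m * (((q : ℂ)⁻¹) ^ (t + 1)) ^ m) := by
      intro m
      simp only [G, Nat.le_add_left, if_true, Nat.add_sub_cancel, pow_add _ m d]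
      ring
    have hG : Summable G := by
      rw [← summable_nat_add_iff d]
      simp only [hGd]
      exact (hS (t + 1)).mul_left _
    have hGsum : ∑' m, G m = (((q : ℂ)⁻¹) ^ (t + 1)) ^ d * S (t + 1) := by
      rw [← hG.sum_add_tsum_nat_add d, Finset.sum_eq_zero, zero_add]
      · simp only [hGd]
        rw [tsum_mul_left]
      · intro m hm
        simp only [G, if_neg (not_le.mpr (Finset.mem_range.mp hm))]
    rw [sub_mul, one_mul, ← hGsum, ← (hS (t + 1)).tsum_sub hG]
    refine tsum_congr fun m => ?_
    nth_rewrite 1 [sparseEulerCoeff_recurrence hq hd m]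
    have : (((q : ℂ)⁻¹) ^ (t + 1)) ^ m = ((q : ℂ)⁻¹) ^ m * (((q : ℂ)⁻¹) ^ t) ^ m := by
      rw [pow_succ, mul_pow, mul_comm]
    simp only [G, this]
    split_ifs <;> ring
  have hprod : ∀ N, S 0 = (∏ t ∈ Finset.range N, (1 - (((q : ℂ)⁻¹) ^ (t + 1)) ^ d)) * S N := by
    intro N
    induction N with
    | zero => simp
    | succ N ih => rw [ih, hrec N, Finset.prod_range_succ, mul_assoc]
  have hlim : Filter.Tendsto S Filter.atTop (nhds 1) := by
    have h1 : ∑' m : ℕ, (if m = 0 then (1 : ℂ) else 0) = 1 := tsum_ite_eq 0 _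
    rw [← h1]
    refine tendsto_tsum_of_dominated_convergence hsum (fun m => ?_)
      (Filter.Eventually.of_forall hbound)
    split_ifs with hm
    · subst hm
      simp [sparseEulerCoeff_zero]
    · have h2 : Filter.Tendsto (fun t : ℕ => (((q : ℂ)⁻¹) ^ t) ^ m) Filter.atTop (nhds 0) := by
        have := (tendsto_pow_atTop_nhds_zero_of_norm_lt_one hr).pow m
        rwa [zero_pow hm] at this
      simpa using h2.const_mul (sparseEulerCoeff q d m)
  have h3 := (multipliable_one_sub_inv_pow_pow (𝕜 := ℂ) hq hd).tendsto_prod_tprod_nat.mul hlim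
  rw [mul_one] at h3
  have h4 : S 0 = ∏' i : ℕ, (1 - (((q : ℂ)⁻¹) ^ (i + 1)) ^ d) := by
    refine tendsto_nhds_unique ?_ h3
    refine tendsto_const_nhds.congr hprod
  rw [← h4]
  simp [S]

theorem tendsto_bCoeff (hq : 1 < q) (hd : d ≠ 0) :
    Filter.Tendsto (fun n => bCoeff q n d) Filter.atTop
      (nhds ((∏' i : ℕ, (1 - (((q : ℂ)⁻¹) ^ (i + 1)) ^ d)) *
        ∏' i : ℕ, (1 - ((q : ℂ)⁻¹) ^ (i + 1))⁻¹)) := by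
  have hc : Filter.Tendsto (eulerInvCoeff q) Filter.atTop
      (nhds (∏' i : ℕ, (1 - ((q : ℂ)⁻¹) ^ (i + 1))⁻¹)) :=
    (multipliable_one_sub_inv_pow_inv hq).tendsto_prod_tprod_nat
  obtain ⟨K, hK⟩ := (Metric.isBounded_range_of_tendsto _ hc).exists_norm_le
  have hK' : ∀ n, ‖eulerInvCoeff q n‖ ≤ K := fun n => hK _ (Set.mem_range_self n)
  -- Extending the convolution by zero gives series over a fixed index set, dominated by a constant
  -- times `‖sparseEulerCoeff q d m‖`.
  have hb : (fun n => bCoeff q n d) = fun n =>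
      ∑' m, sparseEulerCoeff q d m * (if m ≤ n then eulerInvCoeff q (n - m) else 0) := by
    funext n
    rw [bCoeff_eq hq hd, tsum_eq_sum (s := Finset.range (n + 1))]
    · refine Finset.sum_congr rfl fun m hm => ?_
      rw [if_pos (Nat.lt_succ_iff.mp (Finset.mem_range.mp hm))]
    · intro m hm
      rw [if_neg (fun h => hm (Finset.mem_range.mpr (Nat.lt_succ_of_le h))), mul_zero]
  rw [hb, ← tsum_sparseEulerCoeff hq hd, ← tsum_mul_right]
  refine tendsto_tsum_of_dominated_convergence
    ((summable_norm_sparseEulerCoeff hq hd).mul_right K) (fun m => ?_)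
    (Filter.Eventually.of_forall fun n m => ?_)
  · refine Filter.Tendsto.const_mul _ ?_
    refine ((hc.comp (Filter.tendsto_sub_atTop_nat m))).congr' ?_
    filter_upwards [Filter.eventually_ge_atTop m] with n hn
    rw [if_pos hn]; rfl
  · rw [norm_mul]
    refine mul_le_mul_of_nonneg_left ?_ (norm_nonneg _)
    split_ifs
    · exact hK' _
    · rw [norm_zero]
      exact (norm_nonneg _).trans (hK' 0)

/-- For `d = 0` the numerator is `1 - 1`. The generating product, all `b_n(0)` and the claimed limit
then vanish, so this case is treated apart. -/
theorem bFactor_zero (q i : ℕ) : bFactor q 0 i = 0 := by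
  simp [bFactor]

theorem hasProd_bFactor (hq : 1 < q) (d : ℕ) :
    HasProd (fun i : ℕ => bFactor q d (i + 1)) (PowerSeries.mk fun n => bCoeff q n d) := by
  have h : (PowerSeries.mk fun n => bCoeff q n d) = ∏' i : ℕ, bFactor q d (i + 1) := by
    ext n
    rw [PowerSeries.coeff_mk, bCoeff]
  rw [h]
  rcases eq_or_ne d 0 with rfl | hd
  · have h0 : Multipliable fun i : ℕ => bFactor q 0 (i + 1) := by
      simp only [bFactor_zero]
      exact ⟨0, hasProd_zero_zero⟩
    exact h0.hasProd
  · exact (multipliable_bFactor hq hd).hasProd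

theorem multipliable_and_tendsto_bCoeff (hq : 1 < q) (d : ℕ) :
    Multipliable (fun i : ℕ =>
        (1 - (q : ℂ) ^ (-((i + 1 : ℕ) : ℤ) * (d : ℤ))) / (1 - (q : ℂ) ^ (-((i + 1 : ℕ) : ℤ)))) ∧
      Filter.Tendsto (fun n => bCoeff q n d) Filter.atTop
        (nhds (∏' i : ℕ,
          (1 - (q : ℂ) ^ (-((i + 1 : ℕ) : ℤ) * (d : ℤ))) /
            (1 - (q : ℂ) ^ (-((i + 1 : ℕ) : ℤ))))) := by
  have hfun : (fun i : ℕ =>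
      (1 - (q : ℂ) ^ (-((i + 1 : ℕ) : ℤ) * (d : ℤ))) / (1 - (q : ℂ) ^ (-((i + 1 : ℕ) : ℤ)))) =
      fun i => (1 - (((q : ℂ)⁻¹) ^ (i + 1)) ^ d) * (1 - ((q : ℂ)⁻¹) ^ (i + 1))⁻¹ := by
    funext i
    simp only [zpow_mul, zpow_neg, zpow_natCast, inv_pow, div_eq_mul_inv]
  rw [hfun]
  rcases eq_or_ne d 0 with rfl | hd
  · have hb : ∀ n, bCoeff q n 0 = 0 := by
      intro n
      rw [bCoeff]
      simp only [bFactor_zero]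
      rw [tprod_zero, map_zero]
    simp only [hb, pow_zero, sub_self, zero_mul, tprod_zero]
    exact ⟨multipliable_of_exists_eq_zero ⟨0, rfl⟩, tendsto_const_nhds⟩
  · have h1 := multipliable_one_sub_inv_pow_pow (𝕜 := ℂ) hq hd
    have h2 := multipliable_one_sub_inv_pow_inv hq
    refine ⟨h1.mul h2, ?_⟩
    rw [h1.tprod_mul h2]
    exact tendsto_bCoeff hq hd

end GeneratingFunction

/-! ### The main theorem. -/

theorem theoremA {R : Type*} [CommRing R] [IsDomain R] [IsDiscreteValuationRing R]
    [IsAdicComplete (IsLocalRing.maximalIdeal R) R] [Finite (IsLocalRing.ResidueField R)]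
    (q : ℕ) (hq : Nat.card (IsLocalRing.ResidueField R) = q)
    (P : Polynomial R) (hP : P.Monic)
    (hirr : Irreducible (P.map (IsLocalRing.residue R))) :
    -- the events are measurable and have the stated probabilities
    (∀ n : ℕ,
      @MeasurableSet _ (matrixBorel R n) (cokerZeroEvent P n) ∧
      (((haarMatrix R n (cokerZeroEvent P n)).toReal : ℝ) : ℂ) =
        bCoeff q n P.natDegree * ∏ i ∈ Finset.Icc 1 n, (1 - (q : ℂ) ^ (-(i : ℤ)))) ∧
    -- the product defining the generating function converges to it
    (∀ d : ℕ,
      HasProd (fun i : ℕ => bFactor q d (i + 1)) (PowerSeries.mk fun n => bCoeff q n d)) ∧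
    -- the limit of `b_n(d)` as `n → ∞`
    (∀ d : ℕ,
      Multipliable (fun i : ℕ =>
        (1 - (q : ℂ) ^ (-((i + 1 : ℕ) : ℤ) * (d : ℤ))) / (1 - (q : ℂ) ^ (-((i + 1 : ℕ) : ℤ)))) ∧
      Filter.Tendsto (fun n => bCoeff q n d) Filter.atTop
        (nhds (∏' i : ℕ,
          (1 - (q : ℂ) ^ (-((i + 1 : ℕ) : ℤ) * (d : ℤ))) /
            (1 - (q : ℂ) ^ (-((i + 1 : ℕ) : ℤ)))))) ∧
    -- the limit of the probabilities as `n → ∞`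
    Multipliable (fun i : ℕ => 1 - (q : ℝ) ^ (-((i + 1 : ℕ) : ℤ) * (P.natDegree : ℤ))) ∧
    Filter.Tendsto (fun n => (haarMatrix R n (cokerZeroEvent P n)).toReal) Filter.atTop
      (nhds (∏' i : ℕ, (1 - (q : ℝ) ^ (-((i + 1 : ℕ) : ℤ) * (P.natDegree : ℤ))))) := by
  have hq1 : 1 < q := hq ▸ Finite.one_lt_card
  have hd : P.natDegree ≠ 0 := by
    rw [← hP.natDegree_map (IsLocalRing.residue R)]
    exact hirr.natDegree_pos.ne'
  have hprob : ∀ n : ℕ, (((haarMatrix R n (cokerZeroEvent P n)).toReal : ℝ) : ℂ) =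
      bCoeff q n P.natDegree * ∏ j ∈ Finset.range n, (1 - ((q : ℂ)⁻¹) ^ (j + 1)) := by
    intro n
    have h := Matrix.card_isUnit_aeval (P.map (IsLocalRing.residue R)) hirr n
    rw [hP.natDegree_map, hq] at h
    rw [(haarMatrix_cokerZeroEvent P n).2, bCoeff_mul_prod hq1 hd, ← h]
    push_cast
    rfl
  refine ⟨fun n => ⟨(haarMatrix_cokerZeroEvent P n).1, ?_⟩, hasProd_bFactor hq1,
    multipliable_and_tendsto_bCoeff hq1, ?_⟩
  · rw [hprob, Finset.range_eq_Ico, Finset.prod_Ico_add' (fun j : ℕ => 1 - ((q : ℂ)⁻¹) ^ j) 0 n 1]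
    congr 1
    refine Finset.prod_congr (by ext; simp [Nat.succ_le_iff]) fun i _ => ?_
    rw [zpow_neg, zpow_natCast, inv_pow]
  · have hfun : (fun i : ℕ => 1 - (q : ℝ) ^ (-((i + 1 : ℕ) : ℤ) * (P.natDegree : ℤ))) =
        fun i => 1 - (((q : ℝ)⁻¹) ^ (i + 1)) ^ P.natDegree := by
      funext i
      simp only [zpow_mul, zpow_neg, zpow_natCast, inv_pow]
    have hreal := multipliable_one_sub_inv_pow_pow (𝕜 := ℝ) hq1 hd
    -- The case `d = 1` gives the limit of `∏_{j≤n} (1 - q^{-j})`, which cancels the denominator in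
    -- the limit of `b_n`.
    have hV := multipliable_one_sub_inv_pow_pow (𝕜 := ℂ) hq1 one_ne_zero
    simp only [pow_one] at hV
    have hVi := multipliable_one_sub_inv_pow_inv hq1
    rw [hfun]
    refine ⟨hreal, ?_⟩
    have h1 := (tendsto_bCoeff hq1 hd).mul hV.tendsto_prod_tprod_nat
    simp only [← hprob] at h1
    rw [mul_assoc, ← hVi.tprod_mul hV] at h1
    have hone : ∏' i : ℕ, (1 - ((q : ℂ)⁻¹) ^ (i + 1))⁻¹ * (1 - ((q : ℂ)⁻¹) ^ (i + 1)) = 1 :=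
      (tprod_congr fun i =>
        inv_mul_cancel₀ (one_sub_inv_natCast_pow_ne_zero hq1 i)).trans tprod_one
    have hcast : ((∏' i : ℕ, (1 - (((q : ℝ)⁻¹) ^ (i + 1)) ^ P.natDegree) : ℝ) : ℂ) =
        ∏' i : ℕ, (1 - (((q : ℂ)⁻¹) ^ (i + 1)) ^ P.natDegree) := by
      refine (hreal.map_tprod Complex.ofRealHom Complex.continuous_ofReal).trans
        (tprod_congr fun i => ?_)
      simp
    rw [hone, mul_one, ← hcast] at h1
    -- The limit was taken in `ℂ`; real parts bring it back to `ℝ`.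
    exact (Complex.continuous_re.tendsto _).comp h1
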